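/- Let $n\ge 2$ and $\epsilon\in(0,1)$. A bid-reporting (prior-independent) single-item mechanism $M=(x,p)$ for $n$ buyers consists of measurable rules $x_i:\mathbb{R}_+^n\to[0,1]$, with $\sum_i x_i(b)\le 1$ for all $b$, and $p_i:\mathbb{R}_+^n\to\mathbb{R}$, which depend on the bids only. It is incentive compatible (IC) if $v_i x_i(v)-p_i(v)\ge v_i x_i(r,v_{-i})-p_i(r,v_{-i})$, and individually rational (IR) if $v_i x_i(v)-p_i(v)\ge 0$, for all $v\in\mathbb{R}_+^n$, $i\in\{1,\dots,n\}$ and $r\in\mathbb{R}_+$. For a profile $\mathbf F=(F_1,\dots,F_n)$ of distributions on $\mathbb{R}_+$ and independent $v_i\sim F_i$, let $\mathrm{REV}(M;\mathbf F)=\mathbb{E}[\sum_i p_i(v)]\in[-\infty,\infty]$, let $\mathrm{WEL}(\mathbf F)=\mathbb{E}[\max_i v_i]$, and let $\mathrm{SPA}(\mathbf F)$ be the expected second-highest of $v_1,\dots,v_n$ (with multiplicity). A distribution on $\mathbb{R}_+$ with cumulative distribution function $F$ is regular if it has a density $f$ on $\{F<1\}$ (so an atom is allowed only at the top of the support) which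 is positive on $\{0<F<1\}$ and can be chosen so that the virtual value $x-\frac{1-F(x)}{f(x)}$ is nondecreasing there. For $H>1$, the equal-revenue distribution truncated at $H$ is the law of $1/\max\{q,1/H\}$ for $q$ uniform on $[0,1]$. Then for every feasible, IC and IR bid-reporting mechanism $M$ as above there is an $H>1$ such that the equal-revenue distribution $F$ truncated at $H$ is regular and the instance $\mathbf F=(F,\dots,F)$ of identical distributions satisfies $\mathrm{WEL}(\mathbf F)<\infty$ and $$\mathrm{REV}(M;\mathbf F)<\min\{\epsilon\cdot\mathrm{WEL}(\mathbf F),\,(1+\epsilon)\cdot\mathrm{SPA}(\mathbf F)\}.$$ -/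

import Mathlib

open MeasureTheory ProbabilityTheory
open scoped NNReal ENNReal

noncomputable section

/-- A (possibly randomized) single-item bid-reporting, i.e. prior-independent, mechanism for `n`
buyers: at the bid profile `b`, buyer `i` gets the item with probability `alloc b i` and is charged
the (expected) payment `pay b i`. The rules see the bids only, never the distributions. -/
structure BidMechanism (n : ℕ) where
  alloc : (Fin n → ℝ≥0) → Fin n → ℝ
  pay : (Fin n → ℝ≥0) → Fin n → ℝ
  measurable_alloc : Measurable alloc
  measurable_pay : Measurable pay

namespace BidMechanism

variable {n : ℕ}

/-- Single-item feasibility: allocation probabilities are in `[0,1]`, with total at most one. -/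
def Feasible (M : BidMechanism n) : Prop :=
  ∀ b : Fin n → ℝ≥0, (∀ i, 0 ≤ M.alloc b i ∧ M.alloc b i ≤ 1) ∧ ∑ i, M.alloc b i ≤ 1

/-- Utility of buyer `i` with value `v` when the submitted bid profile is `b`. -/
def utility (M : BidMechanism n) (i : Fin n) (v : ℝ≥0) (b : Fin n → ℝ≥0) : ℝ :=
  (v : ℝ) * M.alloc b i - M.pay b i

/-- (Dominant-strategy) incentive compatibility: whatever the others bid (`v j`, `j ≠ i`), bidding
the true value `v i` is at least as good for buyer `i` as any other bid `r`. -/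
def IsIC (M : BidMechanism n) : Prop :=
  ∀ (v : Fin n → ℝ≥0) (i : Fin n) (r : ℝ≥0),
    M.utility i (v i) (Function.update v i r) ≤ M.utility i (v i) v

/-- (Ex-post) individual rationality: a truthful buyer never has negative utility. -/
def IsIR (M : BidMechanism n) : Prop :=
  ∀ (v : Fin n → ℝ≥0) (i : Fin n), 0 ≤ M.utility i (v i) v

/-- Expected revenue under truthful bids drawn independently, `v i ∼ F i`: the expected total
payment, as an extended real number (positive part minus negative part), since payments to the
buyers may have infinite expectation. -/
def revenue (M : BidMechanism n) (F : Fin n → Measure ℝ≥0) : EReal :=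
  ((∫⁻ v, ENNReal.ofReal (∑ i, M.pay v i) ∂(Measure.pi F) : ℝ≥0∞) : EReal) -
    ((∫⁻ v, ENNReal.ofReal (-∑ i, M.pay v i) ∂(Measure.pi F) : ℝ≥0∞) : EReal)

end BidMechanism

/-- The second-highest entry of `v`, with multiplicity: the largest value of `min (v i) (v j)` over
two distinct indices. -/
def secondMax {n : ℕ} (v : Fin n → ℝ≥0) : ℝ≥0∞ :=
  ⨆ (i : Fin n) (j : Fin n) (_ : i ≠ j), ((min (v i) (v j) : ℝ≥0) : ℝ≥0∞)

/-- Optimal social welfare: the expected highest value. -/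
def WEL {n : ℕ} (F : Fin n → Measure ℝ≥0) : ℝ≥0∞ :=
  ∫⁻ v, (⨆ i, (v i : ℝ≥0∞)) ∂(Measure.pi F)

/-- Second-price auction revenue: the expected second-highest value. -/
def SPA {n : ℕ} (F : Fin n → Measure ℝ≥0) : ℝ≥0∞ :=
  ∫⁻ v, secondMax v ∂(Measure.pi F)

/-- The cumulative distribution function of a distribution on the nonnegative reals, on `ℝ`. -/
def cdfNN (F : Measure ℝ≥0) (x : ℝ) : ℝ :=
  cdf (F.map ((↑) : ℝ≥0 → ℝ)) x

/-- Regularity of a distribution on the nonnegative reals. Below the top of its support the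
distribution has a density `f`; on `{0 < F(x) < 1}` (an interval) the density is positive and the
virtual value `x - (1 - F(x)) / f(x)` is nondecreasing. An atom is allowed only at the top of the
support, so that truncated distributions and point masses are included; this is the same as
concavity of the revenue curve `q ↦ q * v(q)`, where `v` is the quantile function. -/
def IsRegularDist (F : Measure ℝ≥0) : Prop :=
  ∃ f : ℝ → ℝ, Measurable f ∧
    (F.map ((↑) : ℝ≥0 → ℝ)).restrict {x | cdfNN F x < 1} =
      (volume.withDensity fun x => ENNReal.ofReal (f x)).restrict {x | cdfNN F x < 1} ∧
    (∀ x, 0 < cdfNN F x → cdfNN F x < 1 → 0 < f x) ∧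
    MonotoneOn (fun x => x - (1 - cdfNN F x) / f x) {x | 0 < cdfNN F x ∧ cdfNN F x < 1}

/-- The equal-revenue distribution truncated at `H`: the law of `v(q) = 1 / max {q, 1/H}` for a
uniform quantile `q ∈ [0,1]`. -/
def truncatedEqualRevenue (H : ℝ) : Measure ℝ≥0 :=
  (volume.restrict (Set.Icc (0 : ℝ) 1)).map fun q => Real.toNNReal (1 / max q (1 / H))

end

/-! The equal-revenue law makes every posted price in [1, H) earn exactly 1, so one buyer yields at
most 1 however large H is. Fixing the other bids turns an IC mechanism into a single-buyer one, and
IR keeps the charge to the zero type nonpositive; hence revenue is at most n for every H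
(`BidMechanism.revenue_le`). Welfare is at least 1 + log H, which is unbounded
(`ofReal_one_add_log_le_WEL`), and the second-price revenue is at least n(1 - 1/H)^(n-1), which
tends to n (`le_SPA_truncatedEqualRevenue`). A large H therefore beats both benchmarks. Regularity
holds because the virtual value vanishes below H. -/

open Set Filter Topology

/-! ### Integrating a monotone subgradient -/

/-- If `-P` is a monotone choice of subgradients of `R` on `[a, b]`, then `R` is recovered from `P`
by integration. -/
theorem integral_eq_sub_of_antitone_subgradient {R P : ℝ → ℝ} {a b : ℝ} (hab : a ≤ b)
    (hP : Antitone P)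
    (hR : ∀ s ∈ Icc a b, ∀ t ∈ Icc a b, R s + (s - t) * P s ≤ R t) :
    ∫ q in a..b, P q = R a - R b := by
  -- The subgradient inequalities at `s` and at `t` bound the error of the linear approximation from
  -- both sides, so `R` has derivative `-P` wherever `P` is continuous.
  have key : ∀ s ∈ Icc a b, ∀ t ∈ Icc a b,
      |R t - R s + (t - s) * P s| ≤ |t - s| * |P t - P s| := by
    intro s hs t ht
    have h1 := hR s hs t ht
    have h2 := hR t ht s hs
    rw [← abs_mul, abs_of_nonneg (by linarith)]
    rw [← abs_neg]
    exact le_trans (by linarith) (le_abs_self _)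
  have hcont : ContinuousOn R (Icc a b) := by
    have hbd : ∀ s ∈ Icc a b, ∀ t ∈ Icc a b, |R t - R s| ≤ |t - s| * (|P a| + |P b|) := by
      intro s hs t ht
      have h1 := hR s hs t ht
      have h2 := hR t ht s hs
      have hb : ∀ u ∈ Icc a b, |P u| ≤ |P a| + |P b| := fun u hu => by
        have h3 := hP hu.1
        have h4 := hP hu.2
        rw [abs_le]
        constructor
        · linarith [neg_abs_le (P b), abs_nonneg (P a)]
        · linarith [le_abs_self (P a), abs_nonneg (P b)]
      have h5 : |(t - s) * P s| ≤ |t - s| * (|P a| + |P b|) := by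
        rw [abs_mul]; exact mul_le_mul_of_nonneg_left (hb s hs) (abs_nonneg _)
      have h6 : |(t - s) * P t| ≤ |t - s| * (|P a| + |P b|) := by
        rw [abs_mul]; exact mul_le_mul_of_nonneg_left (hb t ht) (abs_nonneg _)
      rw [abs_le] at h5 h6 ⊢
      constructor
      · linarith [h5.2]
      · linarith [h6.1]
    refine (LipschitzOnWith.of_dist_le_mul (K := Real.toNNReal (|P a| + |P b|)) ?_).continuousOn
    intro t ht s hs
    rw [Real.coe_toNNReal _ (by positivity), Real.dist_eq, Real.dist_eq, mul_comm]
    exact hbd s hs t ht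
  -- A monotone function has countably many discontinuities, and `R` is continuous across them.
  have h := integral_eq_of_hasDerivAt_off_countable R (fun q => -P q) (a := a) (b := b)
    hP.countable_not_continuousAt (by rwa [uIcc_of_le hab]) ?_ hP.intervalIntegrable.neg
  · rw [intervalIntegral.integral_neg] at h
    linarith
  · rintro x ⟨hx, hxc⟩
    rw [min_eq_left hab, max_eq_right hab] at hx
    have hxc : ContinuousAt P x := by simpa using hxc
    rw [hasDerivAt_iff_isLittleO]
    have hev : ∀ᶠ t in 𝓝 x, t ∈ Icc a b := Icc_mem_nhds hx.1 hx.2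
    have hlim : Tendsto (fun t => P t - P x) (𝓝 x) (𝓝 0) := by
      simpa using hxc.tendsto.sub_const (P x)
    have h1 : (fun t => (t - x) * (P t - P x)) =o[𝓝 x] fun t => t - x := by
      simpa using (Asymptotics.isBigO_refl (fun t => t - x) (𝓝 x)).mul_isLittleO
        ((Asymptotics.isLittleO_one_iff ℝ).2 hlim)
    refine Asymptotics.IsBigO.trans_isLittleO (Asymptotics.IsBigO.of_bound 1 ?_) h1
    filter_upwards [hev] with t ht
    have := key x ⟨hx.1.le, hx.2.le⟩ t ht
    simp only [smul_eq_mul, one_mul, Real.norm_eq_abs, abs_mul]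
    convert this using 2
    ring

/-! ### The truncated equal-revenue law in quantile coordinates -/

/-- The value at quantile `q` of the equal-revenue distribution truncated at `H`. -/
noncomputable def equalRevenueValue (H q : ℝ) : ℝ≥0 := Real.toNNReal (1 / max q (1 / H))

theorem coe_equalRevenueValue {H : ℝ} (hH : 1 < H) (q : ℝ) :
    (equalRevenueValue H q : ℝ) = 1 / max q (1 / H) :=
  Real.coe_toNNReal _ (by
    have : 0 < max q (1 / H) := lt_max_of_lt_right (by positivity)
    positivity)

theorem measurable_equalRevenueValue (H : ℝ) : Measurable (equalRevenueValue H) := by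
  unfold equalRevenueValue
  fun_prop

theorem antitone_equalRevenueValue {H : ℝ} (hH : 1 < H) : Antitone (equalRevenueValue H) := by
  intro s t hst
  rw [← NNReal.coe_le_coe, coe_equalRevenueValue hH, coe_equalRevenueValue hH]
  have : 0 < max s (1 / H) := lt_max_of_lt_right (by positivity)
  gcongr

theorem truncatedEqualRevenue_apply (H : ℝ) {S : Set ℝ≥0} (hS : MeasurableSet S) :
    truncatedEqualRevenue H S = volume (equalRevenueValue H ⁻¹' S ∩ Icc 0 1) := by
  change (Measure.map (equalRevenueValue H) _) S = _
  rw [Measure.map_apply (measurable_equalRevenueValue H) hS,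
    Measure.restrict_apply (measurable_equalRevenueValue H hS)]

theorem isProbabilityMeasure_truncatedEqualRevenue (H : ℝ) :
    IsProbabilityMeasure (truncatedEqualRevenue H) :=
  ⟨by simp [truncatedEqualRevenue_apply]⟩

theorem lintegral_truncatedEqualRevenue (H : ℝ) {g : ℝ≥0 → ℝ≥0∞} (hg : Measurable g) :
    ∫⁻ v, g v ∂truncatedEqualRevenue H = ∫⁻ q in Ioc (0 : ℝ) 1, g (equalRevenueValue H q) := by
  change ∫⁻ v, g v ∂(Measure.map (equalRevenueValue H) _) = _
  rw [lintegral_map hg (measurable_equalRevenueValue H)]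
  exact setLIntegral_congr Ioc_ae_eq_Icc.symm

theorem lintegral_ofReal_eq_intervalIntegral {a b : ℝ} (hab : a ≤ b) {f : ℝ → ℝ}
    (hf : IntervalIntegrable f volume a b) (h0 : ∀ q ∈ Ioc a b, 0 ≤ f q) :
    ∫⁻ q in Ioc a b, ENNReal.ofReal (f q) = ENNReal.ofReal (∫ q in a..b, f q) := by
  rw [intervalIntegral.integral_of_le hab, ofReal_integral_eq_lintegral_ofReal]
  · exact (intervalIntegrable_iff_integrableOn_Ioc_of_le hab).1 hf
  · exact (ae_restrict_iff' measurableSet_Ioc).2 (ae_of_all _ h0)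

/-! ### Revenue from one buyer -/

section SingleBuyer

variable {x p : ℝ≥0 → ℝ}

theorem pay_monotone_of_incentiveCompatible
    (hIC : ∀ v r : ℝ≥0, (v : ℝ) * x r - p r ≤ v * x v - p v) : Monotone p := by
  intro s t hst
  rcases hst.eq_or_lt with rfl | hlt
  · rfl
  have h1 := hIC s t
  have h2 := hIC t s
  have hlt' : (s : ℝ) < t := hlt
  have hx : x s ≤ x t := by
    by_contra! h
    nlinarith [mul_pos (sub_pos.2 hlt') (sub_pos.2 h)]
  nlinarith [mul_nonneg s.2 (sub_nonneg.2 hx)]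

/-- Against a truncated equal-revenue value, an incentive compatible single-buyer mechanism earns at
most `1` on top of what it charges the zero type. -/
theorem lintegral_pay_sub_pay_zero_le_one {H : ℝ} (hH : 1 < H)
    (hx : ∀ v, 0 ≤ x v ∧ x v ≤ 1)
    (hIC : ∀ v r : ℝ≥0, (v : ℝ) * x r - p r ≤ v * x v - p v) :
    ∫⁻ v, ENNReal.ofReal (p v - p 0) ∂truncatedEqualRevenue H ≤ 1 := by
  have hmono := pay_monotone_of_incentiveCompatible hIC
  have hmeas : Measurable fun v => ENNReal.ofReal (p v - p 0) :=
    (hmono.measurable.sub_const _).ennreal_ofReal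
  set P : ℝ → ℝ := fun q => p (equalRevenueValue H q) - p 0 with hPdef
  have hP : Antitone P := fun s t hst =>
    sub_le_sub_right (hmono (antitone_equalRevenueValue hH hst)) _
  have hP0 : ∀ q, 0 ≤ P q := fun q => sub_nonneg.2 (hmono zero_le)
  rw [lintegral_truncatedEqualRevenue H hmeas]
  change ∫⁻ q in Ioc (0 : ℝ) 1, ENNReal.ofReal (P q) ≤ 1
  rw [lintegral_ofReal_eq_intervalIntegral zero_le_one hP.intervalIntegrable fun q _ => hP0 q]
  rw [← ENNReal.ofReal_one]
  refine ENNReal.ofReal_le_ofReal ?_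
  have ha0 : 0 < 1 / H := by positivity
  have ha1 : 1 / H ≤ 1 := by rw [div_le_one (by positivity)]; exact hH.le
  rw [← intervalIntegral.integral_add_adjacent_intervals (b := 1 / H) hP.intervalIntegrable
    hP.intervalIntegrable]
  -- Quantiles up to 1/H form the atom at H.
  have hconst : ∫ q in (0 : ℝ)..(1 / H), P q = 1 / H * P (1 / H) := by
    rw [intervalIntegral.integral_congr (g := fun _ => P (1 / H))]
    · simp
    · intro q hq
      rw [uIcc_of_le ha0.le] at hq
      simp only [hPdef, equalRevenueValue, max_eq_right hq.2, max_self]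
  have hval : ∀ q ∈ Icc (1 / H) 1, q * (equalRevenueValue H q : ℝ) = 1 := by
    intro q hq
    rw [coe_equalRevenueValue hH, max_eq_left hq.1]
    have : 0 < q := ha0.trans_le hq.1
    field_simp
  -- Up to the constant `p 0`, `R q / q` is the utility of type 1/q. Multiplying the IC inequality
  -- of type 1/t against report 1/s by t makes `-P s` a subgradient of `R`.
  have hint := integral_eq_sub_of_antitone_subgradient
    (R := fun q => x (equalRevenueValue H q) - q * P q) ha1 hP (by
      intro s hs t ht
      have h1 := mul_le_mul_of_nonneg_left
        (hIC (equalRevenueValue H t) (equalRevenueValue H s)) (ha0.trans_le ht.1).le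
      have h2 := hval t ht
      simp only [mul_sub, ← mul_assoc, h2] at h1
      simp only [hPdef]
      linarith)
  rw [hconst, hint]
  -- The atom's term cancels the `q * P q` part of `R (1 / H)`, leaving the top allocation minus `R
  -- 1`. Type 1 not gaining by reporting 0 gives `R 1 ≥ x 0 ≥ 0`.
  have h1 := hIC (equalRevenueValue H 1) 0
  have h2 := hval 1 ⟨ha1, le_rfl⟩
  rw [one_mul] at h2
  rw [h2] at h1
  have h3 : P 1 = p (equalRevenueValue H 1) - p 0 := rfl
  linarith [(hx 0).1, (hx (equalRevenueValue H (1 / H))).2]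

end SingleBuyer

/-! ### Revenue from n buyers -/

/-- Integrating out coordinate `i` first. -/
theorem lintegral_pi_le_lintegral_pi_of_update {ι : Type*} [Fintype ι] [DecidableEq ι]
    {X : ι → Type*} [∀ i, MeasurableSpace (X i)] [∀ i, Nonempty (X i)] (μ : ∀ i, Measure (X i))
    [∀ i, SigmaFinite (μ i)] (i : ι) [IsProbabilityMeasure (μ i)] {f g : (∀ i, X i) → ℝ≥0∞}
    (hf : Measurable f) (hg : Measurable g)
    (h : ∀ v, ∫⁻ t, f (Function.update v i t) ∂μ i ≤ ∫⁻ t, g (Function.update v i t) ∂μ i) :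
    ∫⁻ v, f v ∂Measure.pi μ ≤ ∫⁻ v, g v ∂Measure.pi μ := by
  have v₀ : ∀ i, X i := fun i => Classical.arbitrary _
  rw [lintegral_eq_lmarginal_univ v₀, lintegral_eq_lmarginal_univ v₀,
    lmarginal_erase' f hf (Finset.mem_univ i), lmarginal_erase' g hg (Finset.mem_univ i)]
  exact lmarginal_mono (fun v => h v) v₀

theorem BidMechanism.revenue_le {n : ℕ} (M : BidMechanism n) (hfeas : M.Feasible) (hIC : M.IsIC)
    (hIR : M.IsIR) {H : ℝ} (hH : 1 < H) :
    M.revenue (fun _ => truncatedEqualRevenue H) ≤ ((n : ℝ≥0∞) : EReal) := by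
  have := isProbabilityMeasure_truncatedEqualRevenue H
  have hmeas : ∀ i, Measurable fun v : Fin n → ℝ≥0 =>
      ENNReal.ofReal (M.pay v i - M.pay (Function.update v i 0) i) := by
    intro i
    have h1 : Measurable fun v : Fin n → ℝ≥0 => Function.update v i (0 : ℝ≥0) :=
      measurable_pi_iff.2 fun j => by
        rcases eq_or_ne j i with rfl | hj
        · simp
        · simpa [Function.update_of_ne hj] using measurable_pi_apply j
    have h2 := measurable_pi_iff.1 M.measurable_pay i
    exact (h2.sub (h2.comp h1)).ennreal_ofReal
  have hone : ∀ i, ∫⁻ v, ENNReal.ofReal (M.pay v i - M.pay (Function.update v i 0) i)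
      ∂(Measure.pi fun _ : Fin n => truncatedEqualRevenue H) ≤ 1 := by
    intro i
    refine (lintegral_pi_le_lintegral_pi_of_update _ i (hmeas i)
      (measurable_const (a := (1 : ℝ≥0∞))) fun v => ?_).trans (by simp)
    simp only [Function.update_idem, lintegral_one, measure_univ]
    refine lintegral_pay_sub_pay_zero_le_one
      (x := fun t => M.alloc (Function.update v i t) i)
      (p := fun t => M.pay (Function.update v i t) i) hH (fun t => (hfeas _).1 i) ?_
    intro t r
    simpa [BidMechanism.utility] using hIC (Function.update v i t) i r
  have hle : ∫⁻ v, ENNReal.ofReal (∑ i, M.pay v i)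
      ∂(Measure.pi fun _ : Fin n => truncatedEqualRevenue H) ≤ n := by
    calc _ ≤ ∫⁻ v, ∑ i, ENNReal.ofReal (M.pay v i - M.pay (Function.update v i 0) i)
          ∂(Measure.pi fun _ : Fin n => truncatedEqualRevenue H) := by
          refine lintegral_mono fun v => ?_
          refine (ENNReal.ofReal_le_ofReal (Finset.sum_le_sum fun i _ => ?_)).trans
            (Finset.le_sum_of_subadditive _ ENNReal.ofReal_zero.le
              (fun _ _ => ENNReal.ofReal_add_le) _ _)
          -- The utility of a zero type is minus its payment, so IR makes that payment nonpositive.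
          have := hIR (Function.update v i 0) i
          simp only [BidMechanism.utility, Function.update_self, NNReal.coe_zero, zero_mul] at this
          linarith
      _ = ∑ i, ∫⁻ v, ENNReal.ofReal (M.pay v i - M.pay (Function.update v i 0) i)
          ∂(Measure.pi fun _ : Fin n => truncatedEqualRevenue H) :=
          lintegral_finsetSum _ fun i _ => hmeas i
      _ ≤ ∑ _i : Fin n, 1 := Finset.sum_le_sum fun i _ => hone i
      _ = n := by simp
  unfold BidMechanism.revenue
  refine (EReal.sub_le_sub (EReal.coe_ennreal_le_coe_ennreal_iff.2 hle)
    (EReal.coe_ennreal_nonneg _)).trans ?_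
  simp

/-! ### Welfare -/

theorem lintegral_coe_truncatedEqualRevenue {H : ℝ} (hH : 1 < H) :
    ∫⁻ v, (v : ℝ≥0∞) ∂truncatedEqualRevenue H = ENNReal.ofReal (1 + Real.log H) := by
  have ha0 : 0 < 1 / H := by positivity
  have ha1 : 1 / H ≤ 1 := by rw [div_le_one (by positivity)]; exact hH.le
  rw [lintegral_truncatedEqualRevenue H measurable_coe_nnreal_ennreal]
  have hanti : Antitone fun q => (equalRevenueValue H q : ℝ) := fun s t hst =>
    NNReal.coe_le_coe.2 (antitone_equalRevenueValue hH hst)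
  have h := lintegral_ofReal_eq_intervalIntegral zero_le_one
    (hanti.intervalIntegrable (μ := volume) (a := 0) (b := 1)) fun q _ => NNReal.coe_nonneg _
  simp only [ENNReal.ofReal_coe_nnreal] at h
  rw [h, ← intervalIntegral.integral_add_adjacent_intervals (b := 1 / H) hanti.intervalIntegrable
    hanti.intervalIntegrable]
  -- The atom contributes H · (1/H) = 1, the quantiles above 1/H contribute the integral of 1/q.
  congr 2
  · rw [intervalIntegral.integral_congr (g := fun _ => H)]
    · simp; field_simp
    · intro q hq
      rw [uIcc_of_le ha0.le] at hq
      simp only [coe_equalRevenueValue hH, max_eq_right hq.2, one_div_one_div]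
  · rw [intervalIntegral.integral_congr (g := fun q => q⁻¹)]
    · rw [integral_inv_of_pos ha0 one_pos, one_div_one_div]
    · intro q hq
      rw [uIcc_of_le ha1] at hq
      simp only [coe_equalRevenueValue hH, max_eq_left hq.1]
      exact one_div q

theorem lintegral_eval_truncatedEqualRevenue {n : ℕ} {H : ℝ} (hH : 1 < H) (i : Fin n) :
    ∫⁻ v : Fin n → ℝ≥0, (v i : ℝ≥0∞) ∂(Measure.pi fun _ => truncatedEqualRevenue H) =
      ENNReal.ofReal (1 + Real.log H) := by
  have := isProbabilityMeasure_truncatedEqualRevenue H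
  rw [← lintegral_coe_truncatedEqualRevenue hH]
  exact (measurePreserving_eval (fun _ : Fin n => truncatedEqualRevenue H) i).lintegral_comp
    (f := fun t : ℝ≥0 => (t : ℝ≥0∞)) measurable_coe_nnreal_ennreal

theorem WEL_truncatedEqualRevenue_lt_top (n : ℕ) {H : ℝ} (hH : 1 < H) :
    WEL (fun _ : Fin n => truncatedEqualRevenue H) < ⊤ := by
  calc WEL (fun _ : Fin n => truncatedEqualRevenue H)
      ≤ ∫⁻ v : Fin n → ℝ≥0, ∑ i, (v i : ℝ≥0∞) ∂(Measure.pi fun _ => truncatedEqualRevenue H) :=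
        lintegral_mono fun v => iSup_le fun i =>
          Finset.single_le_sum (f := fun i => (v i : ℝ≥0∞)) (fun _ _ => zero_le) (Finset.mem_univ i)
    _ = ∑ i : Fin n, ENNReal.ofReal (1 + Real.log H) := by
        rw [lintegral_finsetSum _ fun i _ => by fun_prop]
        exact Finset.sum_congr rfl fun i _ => lintegral_eval_truncatedEqualRevenue hH i
    _ < ⊤ := ENNReal.sum_lt_top.2 fun _ _ => ENNReal.ofReal_lt_top

theorem ofReal_one_add_log_le_WEL {n : ℕ} (hn : 0 < n) {H : ℝ} (hH : 1 < H) :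
    ENNReal.ofReal (1 + Real.log H) ≤ WEL (fun _ : Fin n => truncatedEqualRevenue H) := by
  rw [← lintegral_eval_truncatedEqualRevenue hH (⟨0, hn⟩ : Fin n)]
  exact lintegral_mono fun v => le_iSup (fun i => (v i : ℝ≥0∞)) _

/-! ### Second-price revenue -/

theorem one_le_mul_truncatedEqualRevenue_Ioi {H : ℝ} (hH : 1 < H) {m : ℝ≥0} (hm : 1 ≤ m)
    (hmH : (m : ℝ) < H) : 1 ≤ (m : ℝ≥0∞) * truncatedEqualRevenue H (Ioi m) := by
  have hm1 : (1 : ℝ) ≤ m := hm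
  have hm0 : (0 : ℝ) < m := by linarith
  have hsub : Ico (0 : ℝ) (1 / m) ⊆ equalRevenueValue H ⁻¹' Ioi m ∩ Icc 0 1 := by
    rintro q ⟨hq0, hq⟩
    refine ⟨?_, hq0, hq.le.trans ((div_le_one hm0).2 hm1)⟩
    rw [mem_preimage, mem_Ioi, ← NNReal.coe_lt_coe, coe_equalRevenueValue hH,
      lt_one_div hm0 (lt_max_of_lt_right (by positivity))]
    exact max_lt hq (one_div_lt_one_div_of_lt hm0 hmH)
  rw [truncatedEqualRevenue_apply H measurableSet_Ioi]
  calc (1 : ℝ≥0∞) = (m : ℝ≥0∞) * volume (Ico (0 : ℝ) (1 / m)) := by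
        rw [Real.volume_Ico, sub_zero, ← ENNReal.ofReal_coe_nnreal,
          ← ENNReal.ofReal_mul hm0.le, mul_one_div_cancel hm0.ne', ENNReal.ofReal_one]
    _ ≤ _ := by gcongr

theorem ofReal_le_truncatedEqualRevenue_Ico {H : ℝ} (hH : 1 < H) :
    ENNReal.ofReal (1 - 1 / H) ≤ truncatedEqualRevenue H (Ico 1 H.toNNReal) := by
  have hsub : Ioc (1 / H) 1 ⊆ equalRevenueValue H ⁻¹' Ico 1 H.toNNReal ∩ Icc 0 1 := by
    rintro q ⟨hq0, hq⟩
    have ha0 : 0 < 1 / H := by positivity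
    have hpos : 0 < q := ha0.trans hq0
    refine ⟨?_, hpos.le, hq⟩
    rw [mem_preimage, mem_Ico, ← NNReal.coe_lt_coe, ← NNReal.coe_le_coe,
      coe_equalRevenueValue hH, Real.coe_toNNReal _ (by linarith), max_eq_left hq0.le]
    refine ⟨by simpa using (one_le_div hpos).2 hq, ?_⟩
    rwa [one_div_lt hpos (by linarith)]
  rw [truncatedEqualRevenue_apply H measurableSet_Ico, ← Real.volume_Ioc]
  exact measure_mono hsub

/-- The highest entry of `v` other than the `i`-th one. -/
noncomputable def maxOthers {n : ℕ} (v : Fin n → ℝ≥0) (i : Fin n) : ℝ≥0 := (Finset.univ.erase i).sup v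

section SecondPrice

variable {n : ℕ}

theorem le_maxOthers (v : Fin n → ℝ≥0) {i j : Fin n} (hij : j ≠ i) : v j ≤ maxOthers v i :=
  Finset.le_sup (f := v) (Finset.mem_erase.2 ⟨hij, Finset.mem_univ j⟩)

theorem exists_maxOthers_eq (hn : 2 ≤ n) (v : Fin n → ℝ≥0) (i : Fin n) :
    ∃ j, j ≠ i ∧ maxOthers v i = v j := by
  have : Nontrivial (Fin n) := Fin.nontrivial_iff_two_le.2 hn
  obtain ⟨j₀, hj₀⟩ := exists_ne i
  obtain ⟨j, hj, h⟩ := Finset.exists_mem_eq_sup (Finset.univ.erase i)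
    ⟨j₀, Finset.mem_erase.2 ⟨hj₀, Finset.mem_univ _⟩⟩ v
  exact ⟨j, (Finset.mem_erase.1 hj).1, h⟩

theorem maxOthers_update (v : Fin n → ℝ≥0) (i : Fin n) (t : ℝ≥0) :
    maxOthers (Function.update v i t) i = maxOthers v i :=
  Finset.sup_congr rfl fun _ hj => Function.update_of_ne (Finset.mem_erase.1 hj).1 _ _

theorem measurable_maxOthers (i : Fin n) : Measurable fun v : Fin n → ℝ≥0 => maxOthers v i := by
  unfold maxOthers
  generalize Finset.univ.erase i = s
  induction s using Finset.induction_on with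
  | empty => simp
  | insert a s _ ih =>
    simp only [Finset.sup_insert]
    exact (measurable_pi_apply a).sup ih

/-- At most one bidder strictly exceeds all others, and the price it faces is then the
second-highest value. With a tie at the top every term vanishes, hence only an inequality. -/
theorem sum_ite_maxOthers_le_secondMax (hn : 2 ≤ n) (v : Fin n → ℝ≥0) :
    ∑ i, (if maxOthers v i < v i then (maxOthers v i : ℝ≥0∞) else 0) ≤ secondMax v := by
  by_cases h : ∃ i, maxOthers v i < v i
  · obtain ⟨i, hi⟩ := h
    rw [Finset.sum_eq_single i]
    · obtain ⟨j, hji, hj⟩ := exists_maxOthers_eq hn v i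
      rw [if_pos hi, hj]
      have hmin : min (v i) (v j) = v j := min_eq_right (hj ▸ hi.le)
      rw [← hmin]
      exact le_iSup_of_le i (le_iSup₂_of_le (f := fun (k : Fin n) (_ : i ≠ k) =>
        ((min (v i) (v k) : ℝ≥0) : ℝ≥0∞)) j hji.symm le_rfl)
    · intro j _ hji
      rw [if_neg]
      exact fun hj => lt_asymm (((le_maxOthers v hji.symm).trans_lt hj).trans_le
        (le_maxOthers v hji)) hi
    · simp
  · push Not at h
    simp [fun i => not_lt.2 (h i)]

/-- Given that the others lie in [1, H), bidder i faces a price m in [1, H) and pays m · P(v_i > m)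
≥ 1 in expectation. By independence this event has probability at least (1 - 1/H)^(n-1); summing
over i gives the factor n. -/
theorem le_SPA_truncatedEqualRevenue (hn : 2 ≤ n) {H : ℝ} (hH : 1 < H) :
    (n : ℝ≥0∞) * ENNReal.ofReal (1 - 1 / H) ^ (n - 1) ≤
      SPA (fun _ : Fin n => truncatedEqualRevenue H) := by
  have := isProbabilityMeasure_truncatedEqualRevenue H
  have hmeas : ∀ i, Measurable fun v : Fin n → ℝ≥0 =>
      if maxOthers v i < v i then (maxOthers v i : ℝ≥0∞) else 0 := fun i =>
    Measurable.ite (measurableSet_lt (measurable_maxOthers i) (measurable_pi_apply i))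
      (measurable_maxOthers i).coe_nnreal_ennreal measurable_const
  have hone : ∀ i, ENNReal.ofReal (1 - 1 / H) ^ (n - 1) ≤ ∫⁻ v : Fin n → ℝ≥0,
      (if maxOthers v i < v i then (maxOthers v i : ℝ≥0∞) else 0)
        ∂(Measure.pi fun _ => truncatedEqualRevenue H) := by
    intro i
    -- Coordinate `i` is left free; the others avoid the atom at H, which `v i` could not strictly
    -- exceed.
    set A : Fin n → Set ℝ≥0 := Function.update (fun _ => Ico 1 H.toNNReal) i univ with hA
    have hAm : ∀ j, MeasurableSet (A j) := by
      intro j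
      rcases eq_or_ne j i with rfl | hj
      · simp [hA]
      · simp [hA, Function.update_of_ne hj]
    have hS : MeasurableSet (Set.pi univ A) := MeasurableSet.univ_pi hAm
    calc ENNReal.ofReal (1 - 1 / H) ^ (n - 1)
        ≤ ∏ j, truncatedEqualRevenue H (A j) := by
          rw [← Finset.mul_prod_erase _ _ (Finset.mem_univ i)]
          have h1 : A i = univ := by simp [hA]
          rw [h1, measure_univ, one_mul]
          calc ENNReal.ofReal (1 - 1 / H) ^ (n - 1)
              = ∏ _j ∈ Finset.univ.erase i, ENNReal.ofReal (1 - 1 / H) := by simp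
            _ ≤ _ := Finset.prod_le_prod' fun j hj => by
                rw [hA, Function.update_of_ne (Finset.mem_erase.1 hj).1]
                exact ofReal_le_truncatedEqualRevenue_Ico hH
      _ = ∫⁻ v, (Set.pi univ A).indicator 1 v
            ∂(Measure.pi fun _ : Fin n => truncatedEqualRevenue H) := by
          rw [lintegral_indicator_one hS, Measure.pi_pi]
      _ ≤ _ := by
          refine lintegral_pi_le_lintegral_pi_of_update _ i (measurable_one.indicator hS)
            (hmeas i) fun v => ?_
          simp only [maxOthers_update, Function.update_self]
          by_cases hv : ∀ j, j ≠ i → v j ∈ Ico 1 H.toNNReal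
          · obtain ⟨j, hji, hj⟩ := exists_maxOthers_eq hn v i
            obtain ⟨hm1, hmH⟩ := hv j hji
            rw [← hj] at hm1 hmH
            have hmH' : (maxOthers v i : ℝ) < H := Real.lt_toNNReal_iff_coe_lt.1 hmH
            calc ∫⁻ t, (Set.pi univ A).indicator 1 (Function.update v i t) ∂truncatedEqualRevenue H
                ≤ ∫⁻ _t, 1 ∂truncatedEqualRevenue H :=
                  lintegral_mono fun t => indicator_le_self _ _ _
              _ ≤ (maxOthers v i : ℝ≥0∞) * truncatedEqualRevenue H (Ioi (maxOthers v i)) := by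
                  simpa using one_le_mul_truncatedEqualRevenue_Ioi hH hm1 hmH'
              _ = ∫⁻ t, (Ioi (maxOthers v i)).indicator (fun _ => (maxOthers v i : ℝ≥0∞)) t
                    ∂truncatedEqualRevenue H := (lintegral_indicator_const measurableSet_Ioi _).symm
              _ = ∫⁻ t, (if maxOthers v i < t then (maxOthers v i : ℝ≥0∞) else 0)
                    ∂truncatedEqualRevenue H := by simp only [indicator_apply, mem_Ioi]
          · have h0 : ∀ t, Function.update v i t ∉ Set.pi univ A := by
              intro t ht
              refine hv fun j hj => ?_
              have := ht j (mem_univ j)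
              rwa [hA, Function.update_of_ne hj, Function.update_of_ne hj] at this
            simp [h0]
  calc (n : ℝ≥0∞) * ENNReal.ofReal (1 - 1 / H) ^ (n - 1)
      = ∑ _i : Fin n, ENNReal.ofReal (1 - 1 / H) ^ (n - 1) := by simp
    _ ≤ ∑ i, ∫⁻ v : Fin n → ℝ≥0, (if maxOthers v i < v i then (maxOthers v i : ℝ≥0∞) else 0)
          ∂(Measure.pi fun _ => truncatedEqualRevenue H) := Finset.sum_le_sum fun i _ => hone i
    _ = ∫⁻ v : Fin n → ℝ≥0, ∑ i, (if maxOthers v i < v i then (maxOthers v i : ℝ≥0∞) else 0)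
          ∂(Measure.pi fun _ => truncatedEqualRevenue H) :=
        (lintegral_finsetSum _ fun i _ => hmeas i).symm
    _ ≤ _ := lintegral_mono fun v => sum_ite_maxOthers_le_secondMax hn v

end SecondPrice

/-! ### Distribution function and regularity -/

theorem map_coe_truncatedEqualRevenue_apply {H : ℝ} (hH : 1 < H) {S : Set ℝ}
    (hS : MeasurableSet S) : (truncatedEqualRevenue H).map ((↑) : ℝ≥0 → ℝ) S =
      volume ({q | 1 / max q (1 / H) ∈ S} ∩ Icc 0 1) := by
  rw [Measure.map_apply measurable_coe_nnreal_real hS,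
    truncatedEqualRevenue_apply H (measurable_coe_nnreal_real hS)]
  simp only [preimage, mem_ofPred_eq, coe_equalRevenueValue hH]

theorem map_coe_truncatedEqualRevenue_Iic_of_lt_one {H t : ℝ} (hH : 1 < H) (ht : t < 1) :
    (truncatedEqualRevenue H).map ((↑) : ℝ≥0 → ℝ) (Iic t) = 0 := by
  rw [map_coe_truncatedEqualRevenue_apply hH measurableSet_Iic]
  convert measure_empty (μ := volume)
  refine eq_empty_of_forall_notMem ?_
  rintro q ⟨hq, -, hq1⟩
  have ha1 : 1 / H ≤ 1 := by rw [div_le_one (by positivity)]; exact hH.le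
  have h1 : (1 : ℝ) ≤ 1 / max q (1 / H) :=
    (one_le_div (lt_max_of_lt_right (by positivity))).2 (max_le hq1 ha1)
  exact absurd (h1.trans hq) (not_le.2 ht)

theorem map_coe_truncatedEqualRevenue_Iic {H t : ℝ} (hH : 1 < H) (ht : 1 ≤ t) (htH : t < H) :
    (truncatedEqualRevenue H).map ((↑) : ℝ≥0 → ℝ) (Iic t) = ENNReal.ofReal (1 - 1 / t) := by
  rw [map_coe_truncatedEqualRevenue_apply hH measurableSet_Iic, ← Real.volume_Icc]
  congr 1
  have ht0 : 0 < t := by linarith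
  ext q
  have hpos : 0 < max q (1 / H) := lt_max_of_lt_right (by positivity)
  have h0 : 0 < 1 / t := by positivity
  have h1 : ¬ 1 / t ≤ 1 / H := not_le.2 (one_div_lt_one_div_of_lt ht0 htH)
  simp only [mem_inter_iff, mem_ofPred_eq, mem_Iic, mem_Icc, one_div_le hpos ht0, le_max_iff, h1,
    or_false]
  exact ⟨fun h => ⟨h.1, h.2.2⟩, fun h => ⟨h.1, h0.le.trans h.1, h.2⟩⟩

theorem map_coe_truncatedEqualRevenue_Iic_of_le {H t : ℝ} (hH : 1 < H) (ht : H ≤ t) :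
    (truncatedEqualRevenue H).map ((↑) : ℝ≥0 → ℝ) (Iic t) = 1 := by
  rw [map_coe_truncatedEqualRevenue_apply hH measurableSet_Iic]
  have : {q : ℝ | 1 / max q (1 / H) ∈ Iic t} = univ := by
    refine eq_univ_of_forall fun q => ?_
    refine le_trans ?_ ht
    rw [one_div_le (lt_max_of_lt_right (by positivity)) (by positivity)]
    exact le_max_right _ _
  rw [this, univ_inter, Real.volume_Icc]
  simp

theorem map_coe_truncatedEqualRevenue_Iio {H : ℝ} (hH : 1 < H) :
    (truncatedEqualRevenue H).map ((↑) : ℝ≥0 → ℝ) (Iio H) = ENNReal.ofReal (1 - 1 / H) := by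
  rw [map_coe_truncatedEqualRevenue_apply hH measurableSet_Iio, ← Real.volume_Ioc]
  congr 1
  ext q
  have hpos : 0 < max q (1 / H) := lt_max_of_lt_right (by positivity)
  have h0 : 0 < 1 / H := by positivity
  simp only [mem_inter_iff, mem_ofPred_eq, mem_Iio, mem_Icc, mem_Ioc,
    one_div_lt hpos (by linarith : 0 < H), lt_max_iff, lt_irrefl, or_false]
  exact ⟨fun h => ⟨h.1, h.2.2⟩, fun h => ⟨h.1, h0.le.trans h.1.le, h.2⟩⟩

theorem cdfNN_truncatedEqualRevenue {H : ℝ} (hH : 1 < H) (t : ℝ) :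
    cdfNN (truncatedEqualRevenue H) t = if t < 1 then 0 else if t < H then 1 - 1 / t else 1 := by
  have := isProbabilityMeasure_truncatedEqualRevenue H
  have : IsProbabilityMeasure ((truncatedEqualRevenue H).map ((↑) : ℝ≥0 → ℝ)) :=
    Measure.isProbabilityMeasure_map measurable_coe_nnreal_real.aemeasurable
  rw [cdfNN, cdf_eq_real, measureReal_def]
  split_ifs with h1 h2
  · rw [map_coe_truncatedEqualRevenue_Iic_of_lt_one hH h1]; simp
  · rw [map_coe_truncatedEqualRevenue_Iic hH (not_lt.1 h1) h2, ENNReal.toReal_ofReal]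
    rw [sub_nonneg, div_le_one (by linarith)]; linarith
  · rw [map_coe_truncatedEqualRevenue_Iic_of_le hH (not_lt.1 h2)]; simp

theorem lintegral_Icc_one_div_sq {t : ℝ} (ht : 1 ≤ t) :
    ∫⁻ x in Icc 1 t, ENNReal.ofReal (1 / x ^ 2) = ENNReal.ofReal (1 - 1 / t) := by
  have h0 : (0 : ℝ) ∉ uIcc 1 t := by
    rw [uIcc_of_le ht]; exact fun h => by linarith [h.1]
  have hint : IntervalIntegrable (fun x : ℝ => x ^ (-2 : ℤ)) volume 1 t :=
    intervalIntegral.intervalIntegrable_zpow (Or.inr h0)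
  have h := lintegral_ofReal_eq_intervalIntegral ht hint fun q hq => by
    have : 0 < q := by linarith [hq.1]
    positivity
  rw [integral_zpow (Or.inr ⟨by norm_num, h0⟩)] at h
  rw [setLIntegral_congr Ioc_ae_eq_Icc.symm]
  convert h using 3
  · simp [zpow_neg]
  · norm_num [zpow_neg]; ring

/-- The density of the untruncated equal-revenue distribution. -/
noncomputable def equalRevenueDensity (x : ℝ) : ℝ := if 1 ≤ x then 1 / x ^ 2 else 0

theorem lintegral_equalRevenueDensity (S : Set ℝ) (hS : MeasurableSet S) :
    (volume.withDensity fun x => ENNReal.ofReal (equalRevenueDensity x)) S =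
      ∫⁻ x in Ici 1 ∩ S, ENNReal.ofReal (1 / x ^ 2) := by
  rw [withDensity_apply _ hS, ← setLIntegral_indicator measurableSet_Ici]
  congr with x
  by_cases hx : 1 ≤ x <;> simp [equalRevenueDensity, indicator, hx]

theorem isRegularDist_truncatedEqualRevenue {H : ℝ} (hH : 1 < H) :
    IsRegularDist (truncatedEqualRevenue H) := by
  have := isProbabilityMeasure_truncatedEqualRevenue H
  have : IsProbabilityMeasure ((truncatedEqualRevenue H).map ((↑) : ℝ≥0 → ℝ)) :=
    Measure.isProbabilityMeasure_map measurable_coe_nnreal_real.aemeasurable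
  have hcdf := cdfNN_truncatedEqualRevenue hH
  -- This set excludes the atom at H, so the untruncated density serves on it.
  have hlt : {x | cdfNN (truncatedEqualRevenue H) x < 1} = Iio H := by
    ext x
    rw [mem_ofPred_eq, hcdf, mem_Iio]
    split_ifs with h1 h2
    · simp; linarith
    · have : 0 < x := by linarith
      simp [h2, this]
    · simpa using h2
  have hmem : ∀ x, 0 < cdfNN (truncatedEqualRevenue H) x →
      cdfNN (truncatedEqualRevenue H) x < 1 → 1 ≤ x ∧ x < H := by
    intro x h0 h1
    have h2 : x ∈ Iio H := hlt ▸ h1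
    rw [hcdf] at h0
    split_ifs at h0 with h3
    · simp at h0
    · exact ⟨not_lt.1 h3, h2⟩
    · exact ⟨not_lt.1 h3, h2⟩
  refine ⟨equalRevenueDensity, ?_, ?_, ?_, ?_⟩
  · exact Measurable.ite measurableSet_Ici (by fun_prop) measurable_const
  · rw [hlt]
    refine Measure.ext_of_Iic _ _ fun t => ?_
    rw [Measure.restrict_apply measurableSet_Iic, Measure.restrict_apply measurableSet_Iic,
      lintegral_equalRevenueDensity _ (measurableSet_Iic.inter measurableSet_Iio)]
    rcases lt_or_ge t H with h | h
    · rw [inter_eq_left.2 (Iic_subset_Iio.2 h), Ici_inter_Iic]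
      rcases lt_or_ge t 1 with h1 | h1
      · rw [map_coe_truncatedEqualRevenue_Iic_of_lt_one hH h1, Icc_eq_empty (not_le.2 h1)]
        simp
      · rw [map_coe_truncatedEqualRevenue_Iic hH h1 h, lintegral_Icc_one_div_sq h1]
    · rw [inter_eq_right.2 (Iio_subset_Iic h), Ici_inter_Iio,
        map_coe_truncatedEqualRevenue_Iio hH, setLIntegral_congr Ico_ae_eq_Icc,
        lintegral_Icc_one_div_sq hH.le]
  · intro x h0 h1
    obtain ⟨h2, -⟩ := hmem x h0 h1
    have : 0 < x := by linarith
    rw [equalRevenueDensity, if_pos h2]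
    positivity
  -- Here 1 - F = 1/x and f = 1/x², so the virtual value is constantly zero.
  · have hzero : ∀ x ∈ {x | 0 < cdfNN (truncatedEqualRevenue H) x ∧
        cdfNN (truncatedEqualRevenue H) x < 1},
        x - (1 - cdfNN (truncatedEqualRevenue H) x) / equalRevenueDensity x = 0 := by
      rintro x ⟨h0, h1⟩
      obtain ⟨h2, h3⟩ := hmem x h0 h1
      have : 0 < x := by linarith
      rw [equalRevenueDensity, if_pos h2, hcdf, if_neg (not_lt.2 h2), if_pos h3]
      field_simp
      ring
    intro x hx y hy _
    simp only [hzero x hx, hzero y hy, le_refl]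

/-! ### Choice of H -/

theorem mainTheorem8 (n : ℕ) (hn : 2 ≤ n) (ε : ℝ) (hε₀ : 0 < ε) (hε₁ : ε < 1)
    (M : BidMechanism n) (hfeas : M.Feasible) (hIC : M.IsIC) (hIR : M.IsIR) :
    ∃ (H : ℝ) (F : Measure ℝ≥0), 1 < H ∧ F = truncatedEqualRevenue H ∧
      IsProbabilityMeasure F ∧ IsRegularDist F ∧ WEL (fun _ : Fin n => F) < ⊤ ∧
      M.revenue (fun _ => F) <
        ((min (ENNReal.ofReal ε * WEL (fun _ : Fin n => F))
          (ENNReal.ofReal (1 + ε) * SPA (fun _ : Fin n => F)) : ℝ≥0∞) : EReal) := by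
  have hn0 : (0 : ℝ) < n := by exact_mod_cast (by omega : 0 < n)
  have hW : ∀ᶠ H : ℝ in atTop, (n : ℝ) < ε * (1 + Real.log H) :=
    ((tendsto_atTop_add_const_left _ 1 Real.tendsto_log_atTop).const_mul_atTop
      hε₀).eventually_gt_atTop _
  -- The limit is (1 + ε)n, strictly above the revenue bound n.
  have hS : ∀ᶠ H : ℝ in atTop, (n : ℝ) < (1 + ε) * (n * (1 - 1 / H) ^ (n - 1)) := by
    have h1 : Tendsto (fun H : ℝ => (1 + ε) * (n * (1 - 1 / H) ^ (n - 1))) atTop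
        (𝓝 ((1 + ε) * (n * (1 - 0) ^ (n - 1)))) :=
      (((tendsto_const_nhds.sub (tendsto_const_nhds.div_atTop tendsto_id)).pow _).const_mul
        _).const_mul _
    refine h1.eventually_const_lt ?_
    simp only [sub_zero, one_pow, mul_one]
    nlinarith
  obtain ⟨H, hHW, hHS, hH⟩ := (hW.and (hS.and (eventually_gt_atTop 1))).exists
  refine ⟨H, _, hH, rfl, isProbabilityMeasure_truncatedEqualRevenue H,
    isRegularDist_truncatedEqualRevenue hH, WEL_truncatedEqualRevenue_lt_top n hH, ?_⟩
  refine (M.revenue_le hfeas hIC hIR hH).trans_lt (EReal.coe_ennreal_lt_coe_ennreal_iff.2 ?_)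
  rw [← ENNReal.ofReal_natCast]
  have ha1 : 0 ≤ 1 - 1 / H := by
    rw [sub_nonneg, div_le_one (by positivity)]; exact hH.le
  refine lt_min ?_ ?_
  · calc ENNReal.ofReal n < ENNReal.ofReal (ε * (1 + Real.log H)) :=
          (ENNReal.ofReal_lt_ofReal_iff_of_nonneg hn0.le).2 hHW
      _ = ENNReal.ofReal ε * ENNReal.ofReal (1 + Real.log H) := ENNReal.ofReal_mul hε₀.le
      _ ≤ _ := by gcongr; exact ofReal_one_add_log_le_WEL (by omega) hH
  · calc ENNReal.ofReal n < ENNReal.ofReal ((1 + ε) * (n * (1 - 1 / H) ^ (n - 1))) :=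
          (ENNReal.ofReal_lt_ofReal_iff_of_nonneg hn0.le).2 hHS
      _ = ENNReal.ofReal (1 + ε) * ((n : ℝ≥0∞) * ENNReal.ofReal (1 - 1 / H) ^ (n - 1)) := by
          rw [ENNReal.ofReal_mul (by linarith), ENNReal.ofReal_mul hn0.le,
            ENNReal.ofReal_natCast, ENNReal.ofReal_pow ha1]
      _ ≤ _ := by gcongr; exact le_SPA_truncatedEqualRevenue hn hH
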